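/- Let $k,b\in\mathbb{C}$ with $k\neq-1$ and $\operatorname{Re}(b)>0$. All complex powers are principal values, $\sec z=1/\cos z$ and $\operatorname{csch}z=1/\sinh z$. Let $\zeta(s,b)$ denote the Hurwitz zeta function, that is, the analytic continuation to $s\in\mathbb{C}\setminus\{1\}$ of $\sum_{j=0}^{\infty}(j+b)^{-s}$ ($\operatorname{Re}(s)>1$); this continuation exists. Then for every integer $n\ge 0$ the following two formulas hold, in which both integrals converge absolutely: $$\sum_{j=0}^{n}(j+b)^k=\frac{(n+b)^{k+1}}{k+1}+\frac{(n+b)^k}{2}+\zeta(-k,b)+\frac{\pi\,(n+b)^{k+2}}{k+1}\int_{0}^{\pi/2}\bigl(\sec v\,\operatorname{csch}(\pi(n+b)\tan v)\bigr)^2\left(1-\frac{\cos((k+1)v)}{(\cos v)^{k+1}}\right)dv,$$ and $$\sum_{j=1}^{n}(j+b)^k=\frac{(n+b)^{k+1}-b^{k+1}}{k+1}+\frac{(n+b)^k-b^k}{2}+\frac{\pi}{k+1}\int_{0}^{\pi/2}(\sec v)^2\Bigl((n+b)^{k+2}\operatorname{csch}^2(\pi(n+b)\tan v)-b^{k+2}\operatorname{csch}^2(\pi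 b\tan v)\Bigr)\left(1-\frac{\cos((k+1)v)}{(\cos v)^{k+1}}\right)dv.$$ -/

import Mathlib

open scoped BigOperators

/-- The complex secant. -/
noncomputable def csec (z : ℂ) : ℂ := 1 / Complex.cos z

/-- The complex hyperbolic cosecant. -/
noncomputable def csch (z : ℂ) : ℂ := 1 / Complex.sinh z

/-- `Z` is an analytic continuation to `ℂ \ {1}` of the Hurwitz series
`s ↦ ∑_{j ≥ 0} (j + b)^(-s)`, `Re s > 1` (powers are principal values). On `ℂ \ {1}` there is
at most one such function, by the identity theorem. -/
def IsHurwitzContinuation (b : ℂ) (Z : ℂ → ℂ) : Prop :=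
  DifferentiableOn ℂ Z {1}ᶜ ∧
    ∀ s : ℂ, 1 < s.re → HasSum (fun j : ℕ => ((j : ℂ) + b) ^ (-s)) (Z s)

open Classical in
/-- The Hurwitz zeta function `ζ(s, b)`: the analytic continuation in `s` of the Hurwitz series
to `ℂ \ {1}` (its value at `s = 1` is irrelevant). The default value `0` is taken only
if there is no continuation. -/
noncomputable def complexHurwitzZeta (s b : ℂ) : ℂ :=
  if h : ∃ Z : ℂ → ℂ, IsHurwitzContinuation b Z then h.choose s else 0

open Complex MeasureTheory Set Filter Topology

/-! Everything rests on a Hermite formula, whose right side is `hermiteZeta`: ζ(s,a) = a^(-s)/2 +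
a^(1-s)/(s-1) + π a^(2-s)/(s-1) · ∫₀^∞ csch²(πat) (1 - E(t)) dt, where E is the even part of
(1+it)^(1-s).

For a > 0 and Re s > 1, Γ(s) ζ(s,a) is the Mellin transform of e^(-ay)/(1-e^(-y))
(`hasSum_hermiteZeta_ofReal`). Split 1/(1-e^(-y)) into 1/2 + 1/y + remainder. The first two parts
are Gamma integrals; the remainder is π/y times the cosine transform of csch²(πu)
(`integral_inv_sinh_sq_mul_one_sub_cos`), and Fubini turns it into the Hermite integral.

The identity theorem in a extends this to Re a > 0. The right side is holomorphic in s ≠ 1, so it is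
the continuation, and the shift ζ(s,b) = Σ_{j<n} (j+b)^(-s) + ζ(s,n+b) persists there. Taking s = -k
and t = tan v gives the first formula; subtracting its case n = 0 gives the second. -/

/-! ### Holomorphic parameter integrals; identity theorem on the right half-plane. -/

/-- Cauchy's estimate bounds the derivative by the majorant of `f` itself, so no domination of the
derivative has to be assumed. -/
theorem differentiableOn_integral_of_locally_dominated {α : Type*} [MeasurableSpace α]
    {μ : Measure α} {U : Set ℂ} (hU : IsOpen U) {f : ℂ → α → ℂ}
    (hmeas : ∀ z ∈ U, AEStronglyMeasurable (f z) μ)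
    (hd : ∀ᵐ t ∂μ, DifferentiableOn ℂ (fun z => f z t) U)
    (hb : ∀ z ∈ U, ∃ V ∈ 𝓝 z, ∃ g : α → ℝ, Integrable g μ ∧ ∀ᵐ t ∂μ, ∀ w ∈ V, ‖f w t‖ ≤ g t) :
    DifferentiableOn ℂ (fun z => ∫ t, f z t ∂μ) U := by
  intro z hz
  obtain ⟨V, hV, g, hg, hfg⟩ := hb z hz
  obtain ⟨r, hr, hrV⟩ := Metric.mem_nhds_iff.1 (inter_mem hV (hU.mem_nhds hz))
  have hder : ∀ᵐ t ∂μ, ∀ w ∈ Metric.ball z (r / 2),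
      HasDerivAt (fun z => f z t) (deriv (fun z => f z t) w) w := by
    filter_upwards [hd] with t ht w hw
    have hwU : w ∈ U := (hrV (Metric.ball_subset_ball (by linarith) hw)).2
    exact ((ht w hwU).differentiableAt (hU.mem_nhds hwU)).hasDerivAt
  have hzb : z ∈ Metric.ball z (r / 2) := Metric.mem_ball_self (by linarith)
  refine (hasDerivAt_integral_of_dominated_loc_of_deriv_le (F := f)
    (F' := fun w t => deriv (fun z => f z t) w) (bound := fun t => g t / (r / 4))
    (Metric.ball_mem_nhds z (half_pos hr)) ?_ ?_ ?_ ?_ (hg.div_const _)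
    hder).2.differentiableAt.differentiableWithinAt
  · filter_upwards [hU.mem_nhds hz] with w hw using hmeas w hw
  · refine hg.mono' (hmeas z hz) ?_
    filter_upwards [hfg] with t ht using ht z (mem_of_mem_nhds hV)
  -- The derivative at `z` is measurable in `t` as a limit of difference quotients along `u n → 0`.
  · let u : ℕ → ℂ := fun n => ((r / 4 / (n + 1) : ℝ) : ℂ)
    have hu0 : ∀ n, u n ≠ 0 := fun n => by
      simp only [u]; exact_mod_cast (by positivity : r / 4 / ((n : ℝ) + 1) ≠ 0)
    have hut : Tendsto u atTop (𝓝 0) := by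
      have h : Tendsto (fun n : ℕ => r / 4 / ((n : ℝ) + 1)) atTop (𝓝 0) := by
        have := (tendsto_one_div_add_atTop_nhds_zero_nat (𝕜 := ℝ)).const_mul (r / 4)
        simpa [div_eq_mul_inv] using this
      exact ((Complex.continuous_ofReal.tendsto 0).comp h).congr fun n => rfl
    have hut' : Tendsto u atTop (𝓝[≠] 0) :=
      tendsto_nhdsWithin_iff.2 ⟨hut, Eventually.of_forall hu0⟩
    refine aestronglyMeasurable_of_tendsto_ae atTop (f := fun n t =>
      (u n)⁻¹ • (f (z + u n) t - f z t)) (fun n => ?_) ?_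
    · refine ((hmeas (z + u n) ?_).sub (hmeas z hz)).const_smul (u n)⁻¹
      refine (hrV ?_).2
      have h1 : r / 4 / ((n : ℝ) + 1) ≤ r / 4 :=
        div_le_self (by positivity) (by linarith [(n.cast_nonneg : (0 : ℝ) ≤ n)])
      have h0 : 0 ≤ r / 4 / ((n : ℝ) + 1) := by positivity
      simp only [u, Metric.mem_ball, dist_self_add_left, Complex.norm_real, Real.norm_eq_abs,
        abs_of_nonneg h0]
      linarith
    · filter_upwards [hder] with t ht
      exact ((hasDerivAt_iff_tendsto_slope_zero.1 (ht z hzb))).comp hut'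
  -- Circles of radius `r / 4` about points of the half-radius ball stay inside the ball where `g`
  -- dominates.
  · filter_upwards [hd, hfg] with t ht htg w hw
    have hsub : Metric.closedBall w (r / 4) ⊆ Metric.ball z r := by
      intro x hx
      have := dist_triangle x w z
      simp only [Metric.mem_closedBall, Metric.mem_ball] at *
      linarith
    refine norm_deriv_le_of_forall_mem_sphere_norm_le (by positivity) ?_ fun x hx =>
      htg x (hrV (hsub (Metric.sphere_subset_closedBall hx))).1
    refine DifferentiableOn.diffContOnCl (ht.mono ?_)
    exact Metric.closure_ball_subset_closedBall.trans (hsub.trans fun x hx => (hrV hx).2)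

theorem isOpen_re_pos : IsOpen {z : ℂ | 0 < z.re} := isOpen_lt continuous_const continuous_re

theorem isPreconnected_re_pos : IsPreconnected {z : ℂ | 0 < z.re} :=
  (convex_halfSpace_re_gt 0).isPreconnected

theorem eqOn_re_pos_of_eq_ofReal {f g : ℂ → ℂ} (hf : DifferentiableOn ℂ f {z | 0 < z.re})
    (hg : DifferentiableOn ℂ g {z | 0 < z.re}) (h : ∀ x : ℝ, 0 < x → f x = g x) :
    EqOn f g {z | 0 < z.re} := by
  refine (hf.analyticOnNhd isOpen_re_pos).eqOn_of_preconnected_of_frequently_eq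
    (hg.analyticOnNhd isOpen_re_pos) isPreconnected_re_pos (z₀ := 1) (by simp) ?_
  have hut : Tendsto (fun n : ℕ => ((1 + 1 / ((n : ℝ) + 1) : ℝ) : ℂ)) atTop (𝓝[≠] 1) := by
    refine tendsto_nhdsWithin_iff.2 ⟨?_, Eventually.of_forall fun n => ?_⟩
    · have h := (tendsto_one_div_add_atTop_nhds_zero_nat (𝕜 := ℝ)).const_add 1
      rw [add_zero] at h
      exact ((Complex.continuous_ofReal.tendsto 1).comp h).congr fun n => rfl
    · have : (1 + 1 / ((n : ℝ) + 1) : ℝ) ≠ 1 := by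
        have : 0 < 1 / ((n : ℝ) + 1) := by positivity
        linarith
      exact fun h => this (ofReal_injective h)
  refine hut.frequently (Frequently.of_forall fun n => h _ (by positivity))

/-! ### The Gamma integral with complex rate. -/

theorem integrableOn_cpow_mul_exp_neg_mul {σ r : ℂ} (hσ : 0 < σ.re) (hr : 0 < r.re) :
    IntegrableOn (fun t : ℝ => (t : ℂ) ^ (σ - 1) * exp (-(r * t))) (Ioi 0) := by
  have h := integrableOn_rpow_mul_exp_neg_mul_rpow (p := 1) (s := σ.re - 1) (b := r.re)
    (by linarith) one_pos hr
  refine Integrable.mono' h ?_ ?_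
  · refine ContinuousOn.aestronglyMeasurable (fun t ht => ?_) measurableSet_Ioi
    refine ContinuousAt.continuousWithinAt (ContinuousAt.mul ?_ (by fun_prop))
    exact (continuousAt_ofReal_cpow_const t _ (Or.inr (ne_of_gt ht)))
  · filter_upwards [ae_restrict_mem measurableSet_Ioi] with t ht
    rw [norm_mul, Complex.norm_cpow_eq_rpow_re_of_pos ht, Complex.norm_exp]
    simp

theorem integral_cpow_mul_exp_neg_mul_of_re_pos {σ r : ℂ} (hσ : 0 < σ.re) (hr : 0 < r.re) :
    ∫ t : ℝ in Ioi 0, (t : ℂ) ^ (σ - 1) * exp (-(r * t)) = r ^ (-σ) * Gamma σ := by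
  refine eqOn_re_pos_of_eq_ofReal
    (f := fun r => ∫ t : ℝ in Ioi 0, (t : ℂ) ^ (σ - 1) * exp (-(r * t)))
    (g := fun r => r ^ (-σ) * Gamma σ) ?_ ?_ ?_ hr
  · refine differentiableOn_integral_of_locally_dominated isOpen_re_pos
      (fun z hz => (integrableOn_cpow_mul_exp_neg_mul hσ hz).aestronglyMeasurable)
      (Eventually.of_forall fun t => by fun_prop) fun z hz => ?_
    have hz' : z.re / 2 < z.re := by simp only [mem_ofPred_eq] at hz; linarith
    refine ⟨{w | z.re / 2 < w.re}, (isOpen_lt continuous_const continuous_re).mem_nhds hz', _,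
      (integrableOn_cpow_mul_exp_neg_mul (σ := σ) (r := ((z.re / 2 : ℝ) : ℂ)) hσ ?_).norm, ?_⟩
    · rw [ofReal_re]; exact half_pos hz
    · filter_upwards [ae_restrict_mem measurableSet_Ioi] with t ht w hw
      rw [norm_mul, norm_mul, Complex.norm_exp, Complex.norm_exp]
      refine mul_le_mul_of_nonneg_left (Real.exp_le_exp.2 ?_) (norm_nonneg _)
      have ht' : 0 < t := ht
      have hw' : z.re / 2 < w.re := hw
      have := mul_lt_mul_of_pos_right hw' ht'
      simp only [neg_re, mul_re, ofReal_re, ofReal_im, mul_zero, sub_zero]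
      linarith
  · intro z hz
    refine DifferentiableAt.differentiableWithinAt (DifferentiableAt.mul_const ?_ _)
    exact (differentiableAt_id.cpow_const (Or.inl hz))
  · intro x hx
    have := Complex.integral_cpow_mul_exp_neg_mul_Ioi hσ hx
    rw [this, one_div, inv_cpow _ _ (by rw [arg_ofReal_of_nonneg hx.le]; exact Real.pi_pos.ne),
      cpow_neg]

/-! ### Bounds for csch. -/

theorem sinh_re_le_norm_sinh (z : ℂ) : Real.sinh z.re ≤ ‖sinh z‖ := by
  have h : ‖exp z - exp (-z)‖ ≥ ‖exp z‖ - ‖exp (-z)‖ := norm_sub_norm_le _ _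
  rw [Complex.norm_exp, Complex.norm_exp, neg_re] at h
  rw [Real.sinh_eq, Complex.sinh, norm_div, Complex.norm_ofNat]
  linarith

theorem sinh_ne_zero_of_re_pos {z : ℂ} (hz : 0 < z.re) : sinh z ≠ 0 := by
  rw [← norm_pos_iff]
  exact (Real.sinh_pos_iff.2 hz).trans_le (sinh_re_le_norm_sinh z)

/-- From sinh x = 2 sinh(x/2) cosh(x/2). A single bound records both the double pole of csch² at 0
and its exponential decay. -/
theorem mul_exp_half_le_sinh {x : ℝ} (hx : 0 ≤ x) : x * Real.exp (x / 2) / 2 ≤ Real.sinh x := by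
  have h1 : x / 2 ≤ Real.sinh (x / 2) := Real.self_le_sinh_iff.2 (by linarith)
  have h2 : Real.exp (x / 2) / 2 ≤ Real.cosh (x / 2) := by
    rw [Real.cosh_eq]; linarith [Real.exp_pos (-(x / 2))]
  have h3 : Real.sinh x = 2 * Real.sinh (x / 2) * Real.cosh (x / 2) := by
    rw [← Real.sinh_two_mul]; ring_nf
  have := mul_le_mul h1 h2 (by positivity) (by linarith)
  rw [h3]; linarith

theorem norm_csch_sq_le {z : ℂ} {x : ℝ} (hx : 0 < x) (hxz : x ≤ z.re) :
    ‖csch z ^ 2‖ ≤ 4 * Real.exp (-x) / x ^ 2 := by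
  have h : x * Real.exp (x / 2) / 2 ≤ ‖sinh z‖ :=
    (mul_exp_half_le_sinh hx.le).trans
      ((Real.sinh_le_sinh.2 hxz).trans (sinh_re_le_norm_sinh z))
  have h0 : 0 < x * Real.exp (x / 2) / 2 := by positivity
  have he : Real.exp (-x) = (Real.exp (x / 2) ^ 2)⁻¹ := by
    rw [← Real.exp_nat_mul, ← Real.exp_neg]; congr 1; push_cast; ring
  calc ‖csch z ^ 2‖ = (‖sinh z‖ ^ 2)⁻¹ := by simp [csch]
    _ ≤ ((x * Real.exp (x / 2) / 2) ^ 2)⁻¹ := by gcongr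
    _ = 4 * Real.exp (-x) / x ^ 2 := by
      rw [he]; field_simp; norm_num

/-! ### The even part of (1+it)^c and its second-order vanishing. -/

/-- The even part of `t ↦ (1 + it)^c`. -/
noncomputable def evenPow (c : ℂ) (t : ℝ) : ℂ := ((1 + t * I) ^ c + (1 - t * I) ^ c) / 2

theorem re_one_add_mul_I (t : ℝ) : (1 + t * I : ℂ).re = 1 := by simp

theorem re_one_sub_mul_I (t : ℝ) : (1 - t * I : ℂ).re = 1 := by simp

theorem norm_cpow_le_of_re_eq_one {z c : ℂ} (hz : z.re = 1) {R T : ℝ} (hc : ‖c‖ ≤ R)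
    (hT : ‖z‖ ≤ 1 + T) : ‖z ^ c‖ ≤ (1 + T) ^ R * Real.exp (Real.pi * R) := by
  have h1 : 1 ≤ ‖z‖ := by have := Complex.abs_re_le_norm z; rwa [hz, abs_one] at this
  have hR : 0 ≤ R := (norm_nonneg c).trans hc
  have hre : c.re ≤ R := (Complex.re_le_norm c).trans hc
  have him : |c.im| ≤ R := (Complex.abs_im_le_norm c).trans hc
  refine (Complex.norm_cpow_le z c).trans ?_
  rw [div_eq_mul_inv, ← Real.exp_neg]
  refine mul_le_mul ?_ ?_ (by positivity) (Real.rpow_nonneg ((norm_nonneg z).trans hT) _)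
  · exact (Real.rpow_le_rpow_of_exponent_le h1 hre).trans
      (Real.rpow_le_rpow (norm_nonneg _) hT hR)
  · rw [Real.exp_le_exp]
    calc -(z.arg * c.im) ≤ |z.arg * c.im| := neg_le_abs _
      _ = |z.arg| * |c.im| := abs_mul _ _
      _ ≤ Real.pi * R := mul_le_mul (abs_arg_le_pi z) him (abs_nonneg _) Real.pi_pos.le

theorem norm_one_add_mul_I_le {t T : ℝ} (ht : 0 ≤ t) (hT : t ≤ T) : ‖(1 + t * I : ℂ)‖ ≤ 1 + T := by
  refine (norm_add_le _ _).trans ?_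
  simp [abs_of_nonneg ht, hT]

theorem norm_one_sub_mul_I_le {t T : ℝ} (ht : 0 ≤ t) (hT : t ≤ T) : ‖(1 - t * I : ℂ)‖ ≤ 1 + T := by
  refine (norm_sub_le _ _).trans ?_
  simp [abs_of_nonneg ht, hT]

theorem hasDerivAt_one_add_mul_I_cpow (c : ℂ) (t : ℝ) :
    HasDerivAt (fun t : ℝ => (1 + t * I : ℂ) ^ c) (c * (1 + t * I) ^ (c - 1) * I) t := by
  have h : HasDerivAt (fun z : ℂ => (1 + z * I) ^ c) (c * (1 + t * I) ^ (c - 1) * (1 * I)) t :=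
    (((hasDerivAt_id (t : ℂ)).mul_const I).const_add 1).cpow_const (Or.inl (by simp))
  simpa using h.comp_ofReal

theorem hasDerivAt_one_sub_mul_I_cpow (c : ℂ) (t : ℝ) :
    HasDerivAt (fun t : ℝ => (1 - t * I : ℂ) ^ c) (-(c * (1 - t * I) ^ (c - 1) * I)) t := by
  have h : HasDerivAt (fun z : ℂ => (1 - z * I) ^ c) (c * (1 - t * I) ^ (c - 1) * (-(1 * I))) t :=
    (((hasDerivAt_id (t : ℂ)).mul_const I).const_sub 1).cpow_const (Or.inl (by simp))
  simpa using h.comp_ofReal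

/-- The function and its first derivative vanish at 0, so the mean value inequality is applied twice
to a bound for the second derivative. The factor t² cancels the double pole of csch². -/
theorem norm_one_sub_evenPow_le {c : ℂ} {R t : ℝ} (hc : ‖c‖ ≤ R) (ht : 0 ≤ t) :
    ‖1 - evenPow c t‖ ≤
      R * (R + 1) * ((1 + t) ^ (R + 2) * Real.exp (Real.pi * (R + 2))) * t ^ 2 := by
  have hR : 0 ≤ R := (norm_nonneg c).trans hc
  have hc1 : ‖c - 1‖ ≤ R + 1 := (norm_sub_le _ _).trans (by simpa using hc)
  have hc2 : ‖c - 1 - 1‖ ≤ R + 2 := by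
    refine (norm_sub_le _ _).trans ?_
    rw [norm_one]; linarith
  set B := (1 + t) ^ (R + 2) * Real.exp (Real.pi * (R + 2))
  have hB : 0 ≤ B := by positivity
  let h1 : ℝ → ℂ := fun x => -(c * ((1 + x * I) ^ (c - 1) - (1 - x * I) ^ (c - 1)) * I / 2)
  have hd0 : ∀ x : ℝ, HasDerivAt (fun x => 1 - evenPow c x) (h1 x) x := fun x => by
    have := (((hasDerivAt_one_add_mul_I_cpow c x).add
      (hasDerivAt_one_sub_mul_I_cpow c x)).div_const 2).const_sub 1
    refine this.congr_deriv ?_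
    simp only [h1]; ring
  have hd1 : ∀ x : ℝ, HasDerivAt h1
      (c * (c - 1) * ((1 + x * I) ^ (c - 1 - 1) + (1 - x * I) ^ (c - 1 - 1)) / 2) x := fun x => by
    have := (((((hasDerivAt_one_add_mul_I_cpow (c - 1) x).sub
      (hasDerivAt_one_sub_mul_I_cpow (c - 1) x)).const_mul c).mul_const I).div_const 2).neg
    refine this.congr_deriv ?_
    linear_combination (-(c * (c - 1) * ((1 + x * I) ^ (c - 1 - 1) +
      (1 - x * I) ^ (c - 1 - 1)) / 2)) * I_mul_I
  have b2 : ∀ x ∈ Icc 0 t, ‖c * (c - 1) * ((1 + x * I) ^ (c - 1 - 1) +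
      (1 - x * I) ^ (c - 1 - 1)) / 2‖ ≤ R * (R + 1) * B := fun x hx => by
    have e1 := norm_cpow_le_of_re_eq_one (re_one_add_mul_I x) hc2
      (norm_one_add_mul_I_le hx.1 hx.2)
    have e2 := norm_cpow_le_of_re_eq_one (re_one_sub_mul_I x) hc2
      (norm_one_sub_mul_I_le hx.1 hx.2)
    rw [norm_div, norm_mul, norm_mul, Complex.norm_ofNat, mul_div_assoc]
    have e3 : ‖(1 + x * I) ^ (c - 1 - 1) + (1 - x * I) ^ (c - 1 - 1)‖ / 2 ≤ B := by
      have := norm_add_le ((1 + x * I) ^ (c - 1 - 1)) ((1 - x * I) ^ (c - 1 - 1))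
      linarith
    gcongr
  have b1 : ∀ x ∈ Icc 0 t, ‖h1 x‖ ≤ R * (R + 1) * B * t := fun x hx => by
    have := (convex_Icc (0 : ℝ) t).norm_image_sub_le_of_norm_hasDerivWithin_le
      (fun y _ => (hd1 y).hasDerivWithinAt) b2 (left_mem_Icc.2 ht) hx
    have h0 : h1 0 = 0 := by simp [h1]
    rw [h0, sub_zero, sub_zero, Real.norm_of_nonneg hx.1] at this
    exact this.trans (by gcongr; exact hx.2)
  have := (convex_Icc (0 : ℝ) t).norm_image_sub_le_of_norm_hasDerivWithin_le
      (fun y _ => (hd0 y).hasDerivWithinAt) b1 (left_mem_Icc.2 ht) (right_mem_Icc.2 ht)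
  have h0 : 1 - evenPow c 0 = 0 := by simp [evenPow]
  rw [h0, sub_zero, sub_zero, Real.norm_of_nonneg ht] at this
  rw [sq, ← mul_assoc]; exact this

/-! ### The Hermite integral: convergence and holomorphy in both parameters. -/

/-- The integrand of the Hermite-type integral. -/
noncomputable def hermiteIntegrand (c a : ℂ) (t : ℝ) : ℂ :=
  csch (Real.pi * a * t) ^ 2 * (1 - evenPow c t)

/-- `∫₀^∞ csch²(πat) (1 - evenPow c t) dt`. -/
noncomputable def hermiteIntegral (c a : ℂ) : ℂ := ∫ t in Ioi (0 : ℝ), hermiteIntegrand c a t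

/-- A majorant of `hermiteIntegrand c a` for `‖c‖ ≤ R` and `δ ≤ Re a`. -/
noncomputable def hermiteBound (R δ t : ℝ) : ℝ :=
  4 * R * (R + 1) * Real.exp (Real.pi * (R + 2)) / δ ^ 2 *
    ((1 + t) ^ (R + 2) * Real.exp (-(δ * t)))

theorem norm_hermiteIntegrand_le {c a : ℂ} {R δ t : ℝ} (hc : ‖c‖ ≤ R) (hδ : 0 < δ)
    (ha : δ ≤ a.re) (ht : 0 < t) : ‖hermiteIntegrand c a t‖ ≤ hermiteBound R δ t := by
  have hre : δ * t ≤ (Real.pi * a * t : ℂ).re := by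
    have : (Real.pi * a * t : ℂ).re = Real.pi * a.re * t := by simp
    rw [this]
    gcongr
    nlinarith [Real.pi_gt_three]
  have hR : 0 ≤ R := (norm_nonneg c).trans hc
  rw [hermiteIntegrand, norm_mul]
  refine (mul_le_mul (norm_csch_sq_le (by positivity) hre)
    (norm_one_sub_evenPow_le hc ht.le) (norm_nonneg _) (by positivity)).trans (le_of_eq ?_)
  rw [hermiteBound]
  field_simp

theorem integrableOn_hermiteBound (R : ℝ) {δ : ℝ} (hδ : 0 < δ) :
    IntegrableOn (hermiteBound R δ) (Ioi 0) := by
  refine Integrable.const_mul ?_ _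
  obtain ⟨N, hN⟩ := exists_nat_ge (R + 2)
  have hmain : IntegrableOn (fun t : ℝ => (1 + t) ^ N * Real.exp (-(δ * t))) (Ioi 0) := by
    refine integrable_of_isBigO_exp_neg (half_pos hδ) (by fun_prop) ?_
    have h1 := (isLittleO_pow_exp_pos_mul_atTop N (half_pos hδ)).isBigO.comp_tendsto
      (tendsto_atTop_add_const_left atTop (1 : ℝ) tendsto_id)
    have h2 := h1.mul (Asymptotics.isBigO_refl (fun t : ℝ => Real.exp (-(δ * t))) atTop)
    refine h2.trans ?_
    -- The constant comes from the shift: e^(δ(1+t)/2) e^(-δt) = e^(δ/2) e^(-δt/2).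
    refine Asymptotics.IsBigO.of_bound (Real.exp (δ / 2)) (Eventually.of_forall fun t => ?_)
    simp only [Function.comp, id]
    rw [← Real.exp_add, Real.norm_of_nonneg (Real.exp_pos _).le,
      Real.norm_of_nonneg (Real.exp_pos _).le, ← Real.exp_add]
    exact Real.exp_le_exp.2 (le_of_eq (by ring))
  refine hmain.mono' ?_ ?_
  · refine ContinuousOn.aestronglyMeasurable (fun t ht => ?_) measurableSet_Ioi
    have : 1 + t ≠ 0 := by have : 0 < t := ht; positivity
    refine ContinuousAt.continuousWithinAt (ContinuousAt.mul ?_ (by fun_prop))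
    exact ContinuousAt.rpow_const (by fun_prop) (Or.inl this)
  · filter_upwards [ae_restrict_mem measurableSet_Ioi] with t ht
    have ht' : 0 < t := ht
    rw [Real.norm_of_nonneg (by positivity), ← Real.rpow_natCast]
    gcongr
    linarith

theorem re_pi_mul_mul_pos {a : ℂ} (ha : 0 < a.re) {t : ℝ} (ht : 0 < t) :
    0 < (Real.pi * a * t : ℂ).re := by
  have : (Real.pi * a * t : ℂ).re = Real.pi * a.re * t := by simp
  rw [this]; positivity

theorem differentiableAt_csch {z : ℂ} (hz : 0 < z.re) : DifferentiableAt ℂ csch z := by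
  have := sinh_ne_zero_of_re_pos hz
  unfold csch
  exact (differentiableAt_const _).div (by fun_prop) this

theorem continuous_evenPow (c : ℂ) : Continuous (evenPow c) := by
  refine Continuous.div_const (Continuous.add ?_ ?_) 2
  · exact continuous_iff_continuousAt.2 fun t => (hasDerivAt_one_add_mul_I_cpow c t).continuousAt
  · exact continuous_iff_continuousAt.2 fun t => (hasDerivAt_one_sub_mul_I_cpow c t).continuousAt

theorem continuousOn_csch_sq {a : ℂ} (ha : 0 < a.re) :
    ContinuousOn (fun t : ℝ => csch (Real.pi * a * t) ^ 2) (Ioi 0) := fun t ht => by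
  have h := (differentiableAt_csch (re_pi_mul_mul_pos ha ht)).continuousAt
  have h2 : ContinuousAt (fun t : ℝ => (Real.pi * a * t : ℂ)) t := by fun_prop
  exact ((ContinuousAt.comp (f := fun t : ℝ => (Real.pi * a * t : ℂ)) h h2).pow
    2).continuousWithinAt

theorem aestronglyMeasurable_hermiteIntegrand (c : ℂ) {a : ℂ} (ha : 0 < a.re) :
    AEStronglyMeasurable (hermiteIntegrand c a) (volume.restrict (Ioi 0)) := by
  refine ContinuousOn.aestronglyMeasurable ?_ measurableSet_Ioi
  exact (continuousOn_csch_sq ha).mul (continuousOn_const.sub (continuous_evenPow c).continuousOn)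

theorem integrableOn_hermiteIntegrand (c : ℂ) {a : ℂ} (ha : 0 < a.re) :
    IntegrableOn (hermiteIntegrand c a) (Ioi 0) := by
  refine (integrableOn_hermiteBound ‖c‖ ha).mono' (aestronglyMeasurable_hermiteIntegrand c ha) ?_
  filter_upwards [ae_restrict_mem measurableSet_Ioi] with t ht
  exact norm_hermiteIntegrand_le le_rfl ha le_rfl ht

theorem differentiable_hermiteIntegral_left {a : ℂ} (ha : 0 < a.re) :
    Differentiable ℂ (fun c => hermiteIntegral c a) := by
  rw [← differentiableOn_univ]
  refine differentiableOn_integral_of_locally_dominated isOpen_univ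
    (fun c _ => aestronglyMeasurable_hermiteIntegrand c ha) (Eventually.of_forall fun t => ?_)
    fun c _ => ?_
  · have h1 : (1 + t * I : ℂ) ≠ 0 := fun h => by simpa using congrArg re h
    have h2 : (1 - t * I : ℂ) ≠ 0 := fun h => by simpa using congrArg re h
    refine Differentiable.differentiableOn fun z => ?_
    unfold hermiteIntegrand evenPow
    refine DifferentiableAt.const_mul (DifferentiableAt.const_sub (DifferentiableAt.div_const
      (DifferentiableAt.add ?_ ?_) _) _) _
    · exact differentiableAt_id.const_cpow (Or.inl h1)
    · exact differentiableAt_id.const_cpow (Or.inl h2)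
  · refine ⟨Metric.ball 0 (‖c‖ + 1), Metric.isOpen_ball.mem_nhds (by simp), _,
      integrableOn_hermiteBound (‖c‖ + 1) ha, ?_⟩
    filter_upwards [ae_restrict_mem measurableSet_Ioi] with t ht w hw
    exact norm_hermiteIntegrand_le (mem_ball_zero_iff.1 hw).le ha le_rfl ht

theorem differentiableOn_hermiteIntegral_right (c : ℂ) :
    DifferentiableOn ℂ (fun a => hermiteIntegral c a) {a | 0 < a.re} := by
  refine differentiableOn_integral_of_locally_dominated isOpen_re_pos
    (fun a ha => aestronglyMeasurable_hermiteIntegrand c ha) ?_ fun a ha => ?_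
  · filter_upwards [ae_restrict_mem measurableSet_Ioi] with t ht a ha
    have h := differentiableAt_csch (re_pi_mul_mul_pos ha ht)
    have h2 : DifferentiableAt ℂ (fun a : ℂ => (Real.pi * a * t : ℂ)) a := by fun_prop
    exact (((DifferentiableAt.comp (f := fun a : ℂ => (Real.pi * a * t : ℂ)) a h h2).pow
      2).mul_const _).differentiableWithinAt
  · have ha0 : 0 < a.re := ha
    have ha' : a.re / 2 < a.re := by linarith
    refine ⟨{w | a.re / 2 < w.re}, (isOpen_lt continuous_const continuous_re).mem_nhds ha', _,
      integrableOn_hermiteBound ‖c‖ (half_pos ha0), ?_⟩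
    filter_upwards [ae_restrict_mem measurableSet_Ioi] with t ht w hw
    exact norm_hermiteIntegrand_le le_rfl (half_pos ha0) (le_of_lt hw) ht

/-! ### The cosine transform of csch². -/

/-- This is 4 Σ m q^m = 4q/(1-q)² at q = e^(-2x), with the vanishing term m = 0 dropped. -/
theorem hasSum_inv_sinh_sq {x : ℝ} (hx : 0 < x) :
    HasSum (fun n : ℕ => 4 * ((n : ℝ) + 1) * Real.exp (-(2 * (n + 1) * x)))
      (1 / Real.sinh x ^ 2) := by
  have hr : Real.exp (-(2 * x)) < 1 := Real.exp_lt_one_iff.2 (by linarith)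
  have h := (hasSum_coe_mul_geometric_of_norm_lt_one (𝕜 := ℝ) (r := Real.exp (-(2 * x)))
    (by rwa [Real.norm_of_nonneg (Real.exp_pos _).le])).mul_left 4
  rw [← hasSum_nat_add_iff' 1] at h
  convert! h using 1
  · ext n
    rw [← Real.exp_nat_mul]
    push_cast
    ring_nf
  · have e1 : Real.exp (-(2 * x)) = (Real.exp x ^ 2)⁻¹ := by
      rw [← Real.exp_nat_mul, ← Real.exp_neg]; push_cast; rfl
    have e2 : (1 : ℝ) < Real.exp x := Real.one_lt_exp_iff.2 hx
    have e3 : Real.exp x ^ 2 - 1 ≠ 0 := by nlinarith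
    rw [Real.sinh_eq, Real.exp_neg, e1]
    simp only [Finset.range_one, Finset.sum_singleton, Nat.cast_zero, zero_mul, mul_zero, sub_zero]
    have : Real.exp x ≠ 0 := by positivity
    have e4 : Real.exp x - (Real.exp x)⁻¹ = (Real.exp x ^ 2 - 1) / Real.exp x := by field_simp
    have e5 : 1 - (Real.exp x ^ 2)⁻¹ = (Real.exp x ^ 2 - 1) / Real.exp x ^ 2 := by field_simp
    rw [e4, e5]
    field_simp
    norm_num

theorem integrableOn_exp_neg_mul_one_sub_cos {p : ℝ} (hp : 0 < p) (y : ℝ) :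
    IntegrableOn (fun u : ℝ => Real.exp (-(p * u)) * (1 - Real.cos (y * u))) (Ioi 0) := by
  have h := (exp_neg_integrableOn_Ioi 0 hp).mul_const 2
  refine h.mono' (by fun_prop) (Eventually.of_forall fun u => ?_)
  rw [neg_mul, norm_mul, Real.norm_of_nonneg (Real.exp_pos _).le, Real.norm_of_nonneg
    (by linarith [Real.cos_le_one (y * u)])]
  gcongr
  linarith [Real.neg_one_le_cos (y * u)]

theorem integral_exp_neg_mul_one_sub_cos {p : ℝ} (hp : 0 < p) (y : ℝ) :
    ∫ u : ℝ in Ioi 0, Real.exp (-(p * u)) * (1 - Real.cos (y * u)) =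
      y ^ 2 / (p * (p ^ 2 + y ^ 2)) := by
  have r0 : (-(p : ℂ)).re < 0 := by simpa using hp
  have r1 : (-(p : ℂ) + y * I).re < 0 := by simpa using hp
  have r2 : (-(p : ℂ) - y * I).re < 0 := by simpa using hp
  have i0 := integrableOn_exp_mul_complex_Ioi r0 0
  have i1 := integrableOn_exp_mul_complex_Ioi r1 0
  have i2 := integrableOn_exp_mul_complex_Ioi r2 0
  apply ofReal_injective
  rw [← integral_complex_ofReal]
  have : ∀ u : ℝ, ((Real.exp (-(p * u)) * (1 - Real.cos (y * u)) : ℝ) : ℂ) =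
      exp (-(p : ℂ) * u) - (exp ((-(p : ℂ) + y * I) * u) + exp ((-(p : ℂ) - y * I) * u)) / 2 := by
    intro u
    push_cast
    rw [add_mul, sub_mul, exp_add, sub_eq_add_neg (-(p : ℂ) * u), exp_add, Complex.cos]
    ring_nf
  simp_rw [this]
  rw [integral_sub i0 ?_, integral_div, integral_add i1 i2,
    integral_exp_mul_complex_Ioi r0, integral_exp_mul_complex_Ioi r1,
    integral_exp_mul_complex_Ioi r2]
  swap
  · exact (i1.add i2).div_const 2
  have n0 : (p : ℂ) ≠ 0 := ofReal_ne_zero.2 hp.ne'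
  have n1 : -(p : ℂ) + y * I ≠ 0 := fun h => by rw [h] at r1; simp at r1
  have n2 : -(p : ℂ) - y * I ≠ 0 := fun h => by rw [h] at r2; simp at r2
  have n3 : (p : ℂ) ^ 2 + y ^ 2 ≠ 0 := by
    have : (p : ℂ) ^ 2 + y ^ 2 = (-(p : ℂ) + y * I) * (-(p : ℂ) - y * I) := by
      linear_combination (y : ℂ) ^ 2 * I_sq
    rw [this]; exact mul_ne_zero n1 n2
  have key : -(1 : ℂ) / (-p + y * I) + -1 / (-p - y * I) = 2 * p / (p ^ 2 + y ^ 2) := by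
    rw [div_add_div _ _ n1 n2, div_eq_div_iff (mul_ne_zero n1 n2) n3]
    linear_combination (2 * p * (y : ℂ) ^ 2) * I_sq
  simp only [ofReal_zero, mul_zero, exp_zero]
  rw [key]
  push_cast
  field_simp
  ring

/-- The partial fraction expansion of the cotangent, evaluated at the imaginary point iy/(2π). -/
theorem hasSum_coth {y : ℝ} (hy : 0 < y) :
    HasSum (fun n : ℕ => y ^ 2 / ((2 * Real.pi * (n + 1)) ^ 2 + y ^ 2))
      (y / 2 * (1 / (1 - Real.exp (-y)) - 1 / 2 - 1 / y)) := by
  set x : ℂ := ((y / (2 * Real.pi) : ℝ) : ℂ) * I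
  have him : 0 < x.im := by
    simp only [x, mul_im, ofReal_re, ofReal_im, I_im, I_re, mul_one, mul_zero, add_zero]
    positivity
  have hx : x ∈ Complex.integerComplement := by
    have := UpperHalfPlane.coe_mem_integerComplement ⟨x, him⟩
    exact this
  have hs := (summable_cotTerm hx).hasSum
  have hc := cot_series_rep' hx
  have hpi : (Real.pi : ℂ) ≠ 0 := ofReal_ne_zero.2 Real.pi_ne_zero
  have hyc : (y : ℂ) ≠ 0 := ofReal_ne_zero.2 hy.ne'
  have hE : (exp (-y) : ℂ) ≠ 1 := by
    rw [← ofReal_neg, ← ofReal_exp]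
    exact_mod_cast (Real.exp_lt_one_iff.2 (neg_lt_zero.2 hy)).ne
  have hE' : (1 : ℂ) - exp (-y) ≠ 0 := sub_ne_zero.2 hE.symm
  have hx0 : x = y / (2 * Real.pi) * I := by simp [x]
  rw [← hc] at hs
  have h := hs.mul_left (I * y / (4 * Real.pi))
  rw [← Complex.hasSum_ofReal]
  convert! h using 1
  · ext n
    rw [cotTerm_identity hx]
    have e1 : (x + (n + 1)) * (x - (n + 1)) =
        -((2 * Real.pi * (n + 1)) ^ 2 + y ^ 2) / (2 * Real.pi) ^ 2 := by
      rw [hx0]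
      field_simp
      linear_combination (y : ℂ) ^ 2 * I_sq
    have e2 : ((2 * Real.pi * (n + 1)) ^ 2 + y ^ 2 : ℂ) ≠ 0 := by
      have : ((2 * Real.pi * (n + 1)) ^ 2 + y ^ 2 : ℝ) ≠ 0 := by positivity
      exact_mod_cast this
    rw [e1, hx0]
    push_cast
    generalize ((2 * Real.pi * (n + 1)) ^ 2 + y ^ 2 : ℂ) = D at e2 ⊢
    have e3 : I * y / (4 * Real.pi) * (2 * (y / (2 * Real.pi) * I) * (1 / (-D / (2 * Real.pi) ^ 2)))
        = -I ^ 2 * (y ^ 2 / D) := by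
      field_simp
      norm_num
    rw [e3, I_sq]
    ring
  · have e3 : 2 * I * (Real.pi * x) = -y := by
      rw [hx0]; field_simp; linear_combination I_sq
    rw [Complex.cot_eq_exp_ratio, e3, hx0]
    push_cast
    field_simp
    ring

/-- The cosine transform of `1 / sinh²`. -/
theorem integral_inv_sinh_sq_mul_one_sub_cos {y : ℝ} (hy : 0 < y) :
    ∫ u : ℝ in Ioi 0, 1 / Real.sinh (Real.pi * u) ^ 2 * (1 - Real.cos (y * u)) =
      y / Real.pi * (1 / (1 - Real.exp (-y)) - 1 / 2 - 1 / y) := by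
  let F : ℕ → ℝ → ℝ := fun n u =>
    4 * ((n : ℝ) + 1) * (Real.exp (-(2 * Real.pi * (n + 1) * u)) * (1 - Real.cos (y * u)))
  have hp : ∀ n : ℕ, 0 < 2 * Real.pi * ((n : ℝ) + 1) := fun n => by positivity
  have hF0 : ∀ n u, 0 ≤ F n u := fun n u => by
    have := Real.cos_le_one (y * u)
    exact mul_nonneg (by positivity) (mul_nonneg (by positivity) (by linarith))
  have hFi : ∀ n, IntegrableOn (F n) (Ioi 0) := fun n =>
    (integrableOn_exp_neg_mul_one_sub_cos (hp n) y).const_mul _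
  have hFv : ∀ n, ∫ u in Ioi 0, F n u =
      2 / Real.pi * (y ^ 2 / ((2 * Real.pi * (n + 1)) ^ 2 + y ^ 2)) := fun n => by
    simp only [F]
    rw [integral_const_mul, integral_exp_neg_mul_one_sub_cos (hp n)]
    field_simp
    norm_num
  have hs := (hasSum_coth hy).mul_left (2 / Real.pi)
  -- All terms are nonnegative, so summability of their integrals, known from `hasSum_coth`,
  -- justifies termwise integration.
  have h := hasSum_integral_of_summable_integral_norm (μ := volume.restrict (Ioi 0)) hFi (by
    simp_rw [Real.norm_of_nonneg (hF0 _ _), hFv]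
    exact hs.summable)
  simp_rw [hFv] at h
  have heq := h.unique hs
  have hcongr : ∫ u : ℝ in Ioi 0, 1 / Real.sinh (Real.pi * u) ^ 2 * (1 - Real.cos (y * u)) =
      ∫ u : ℝ in Ioi 0, ∑' n, F n u := by
    refine setIntegral_congr_fun measurableSet_Ioi fun u hu => ?_
    have := (hasSum_inv_sinh_sq (mul_pos Real.pi_pos hu)).mul_right (1 - Real.cos (y * u))
    rw [← this.tsum_eq]
    refine tsum_congr fun n => ?_
    simp only [F]
    ring_nf
  rw [hcongr, heq]
  field_simp

/-! ### Hermite's formula for a > 0 and Re s > 1. -/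

theorem ofReal_mul_cpow {a : ℝ} (ha : 0 < a) {z : ℂ} (hz : z ≠ 0) (c : ℂ) :
    ((a : ℂ) * z) ^ c = (a : ℂ) ^ c * z ^ c := by
  have ha' : (a : ℂ) ≠ 0 := ofReal_ne_zero.2 ha.ne'
  rw [cpow_def_of_ne_zero (mul_ne_zero ha' hz), cpow_def_of_ne_zero ha', cpow_def_of_ne_zero hz,
    log_ofReal_mul ha hz, add_mul, exp_add, ofReal_log ha.le]

/-- Writing the cosine by exponentials gives Gamma integrals of rates a and a(1 ± it); the last two
average to `evenPow`. -/
theorem integral_cpow_mul_exp_neg_mul_one_sub_cos {σ : ℂ} (hσ : 0 < σ.re) {a : ℝ} (ha : 0 < a)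
    (t : ℝ) :
    ∫ y : ℝ in Ioi 0, (y : ℂ) ^ (σ - 1) * exp (-(a * y)) * (1 - Real.cos (a * t * y) : ℝ) =
      a ^ (-σ) * Gamma σ * (1 - evenPow (-σ) t) := by
  have r0 : 0 < (a : ℂ).re := by simpa using ha
  have r1 : 0 < (a * (1 + t * I) : ℂ).re := by simpa using ha
  have r2 : 0 < (a * (1 - t * I) : ℂ).re := by simpa using ha
  have i0 := integrableOn_cpow_mul_exp_neg_mul hσ r0
  have i1 := integrableOn_cpow_mul_exp_neg_mul hσ r1
  have i2 := integrableOn_cpow_mul_exp_neg_mul hσ r2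
  have n1 : (1 + t * I : ℂ) ≠ 0 := fun h => by simpa using congrArg re h
  have n2 : (1 - t * I : ℂ) ≠ 0 := fun h => by simpa using congrArg re h
  have hpt : ∀ y : ℝ, (y : ℂ) ^ (σ - 1) * exp (-(a * y)) * (1 - Real.cos (a * t * y) : ℝ) =
      (y : ℂ) ^ (σ - 1) * exp (-(a * y)) - ((y : ℂ) ^ (σ - 1) * exp (-(a * (1 + t * I) * y)) +
        (y : ℂ) ^ (σ - 1) * exp (-(a * (1 - t * I) * y))) / 2 := by
    intro y
    have e1 : exp (-(a * (1 + t * I) * y) : ℂ) = exp (-(a * y)) * exp (-(a * t * y) * I) := by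
      rw [← exp_add]; ring_nf
    have e2 : exp (-(a * (1 - t * I) * y) : ℂ) = exp (-(a * y)) * exp (a * t * y * I) := by
      rw [← exp_add]; ring_nf
    rw [e1, e2]
    push_cast
    rw [Complex.cos]
    ring
  simp_rw [hpt]
  rw [integral_sub i0 ?_, integral_div, integral_add i1 i2,
    integral_cpow_mul_exp_neg_mul_of_re_pos hσ r0, integral_cpow_mul_exp_neg_mul_of_re_pos hσ r1,
    integral_cpow_mul_exp_neg_mul_of_re_pos hσ r2, ofReal_mul_cpow ha n1, ofReal_mul_cpow ha n2,
    evenPow]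
  · ring
  · exact (i1.add i2).div_const 2

/-- The integrand of the double integral for `Γ(σ) a^(-σ)` times the Hermite-type integral. -/
noncomputable def hermiteKernel (σ : ℂ) (a t y : ℝ) : ℂ :=
  csch (Real.pi * a * t) ^ 2 *
    ((y : ℂ) ^ (σ - 1) * exp (-(a * y)) * (1 - Real.cos (a * t * y) : ℝ))

theorem measurable_csch : Measurable csch := by
  unfold csch; exact measurable_const.div Complex.measurable_sinh

/-- Since 1 - cos(aty) ≤ (aty)²/2, the factor t² cancels the pole of csch² and leaves a product
majorant in t and y. -/
theorem integrable_hermiteKernel {σ : ℂ} (hσ : 0 < σ.re) {a : ℝ} (ha : 0 < a) :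
    Integrable (Function.uncurry (hermiteKernel σ a))
      ((volume.restrict (Ioi 0)).prod (volume.restrict (Ioi 0))) := by
  have h1 : IntegrableOn (fun t : ℝ => 4 / (Real.pi * a) ^ 2 * Real.exp (-(Real.pi * a) * t))
    (Ioi 0) := (exp_neg_integrableOn_Ioi 0 (by positivity)).const_mul _
  have h2 : IntegrableOn (fun y : ℝ => a ^ 2 / 2 * (y ^ (σ.re + 1) * Real.exp (-a * y ^ (1 : ℝ))))
    (Ioi 0) := (integrableOn_rpow_mul_exp_neg_mul_rpow (by linarith) one_pos ha).const_mul _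
  refine (Integrable.mul_prod h1 h2).mono' ?_ ?_
  · refine Measurable.aestronglyMeasurable ?_
    unfold Function.uncurry hermiteKernel
    have := measurable_csch
    fun_prop
  · rw [Measure.prod_restrict]
    filter_upwards [ae_restrict_mem (measurableSet_Ioi.prod measurableSet_Ioi)] with p hp
    obtain ⟨t, y⟩ := p
    have ht : 0 < t := hp.1
    have hy : 0 < y := hp.2
    have hx : 0 < Real.pi * a * t := by positivity
    have hc0 : 0 ≤ 1 - Real.cos (a * t * y) := by linarith [Real.cos_le_one (a * t * y)]
    have hc1 : 1 - Real.cos (a * t * y) ≤ (a * t * y) ^ 2 / 2 := by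
      linarith [Real.one_sub_sq_div_two_le_cos (x := a * t * y)]
    have hcs := norm_csch_sq_le (z := (Real.pi * a * t : ℂ)) hx (by simp)
    have hexp : ‖exp (-(a * y) : ℂ)‖ = Real.exp (-a * y) := by
      rw [Complex.norm_exp]; simp
    have hpow : y ^ (σ.re + 1) = y ^ (σ.re - 1) * y ^ 2 := by
      rw [← Real.rpow_natCast, ← Real.rpow_add hy]; ring_nf
    simp only [Function.uncurry, hermiteKernel, Real.rpow_one]
    rw [norm_mul, norm_mul, norm_mul, Complex.norm_cpow_eq_rpow_re_of_pos hy, hexp,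
      Complex.norm_real, Real.norm_of_nonneg hc0, hpow]
    have hσ1 : (σ - 1).re = σ.re - 1 := by simp
    rw [hσ1]
    calc _ ≤ 4 * Real.exp (-(Real.pi * a * t)) / (Real.pi * a * t) ^ 2 *
          (y ^ (σ.re - 1) * Real.exp (-a * y) * ((a * t * y) ^ 2 / 2)) := by gcongr
      _ = _ := by
        rw [neg_mul]
        field_simp

theorem integral_hermiteKernel_left (σ : ℂ) {a y : ℝ} (ha : 0 < a) (hy : 0 < y) :
    ∫ t in Ioi 0, hermiteKernel σ a t y =
      (1 / (a * Real.pi)) * ((y : ℂ) ^ σ * exp (-(a * y)) *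
        (1 / (1 - exp (-y)) - 1 / 2 - 1 / y)) := by
  have hg := integral_comp_mul_left_Ioi
    (fun u : ℝ => 1 / Real.sinh (Real.pi * u) ^ 2 * (1 - Real.cos (y * u))) 0 ha
  rw [mul_zero, integral_inv_sinh_sq_mul_one_sub_cos hy] at hg
  have hy' : (y : ℂ) ≠ 0 := ofReal_ne_zero.2 hy.ne'
  have ha' : (a : ℂ) ≠ 0 := ofReal_ne_zero.2 ha.ne'
  have hpi : (Real.pi : ℂ) ≠ 0 := ofReal_ne_zero.2 Real.pi_ne_zero
  have hk : ∀ t : ℝ, hermiteKernel σ a t y = (y : ℂ) ^ (σ - 1) * exp (-(a * y)) *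
      ((1 / Real.sinh (Real.pi * (a * t)) ^ 2 * (1 - Real.cos (y * (a * t))) : ℝ) : ℂ) := by
    intro t
    simp only [hermiteKernel, csch]
    push_cast
    ring_nf
  simp_rw [hk]
  rw [integral_const_mul, integral_complex_ofReal, hg, cpow_sub _ _ hy', cpow_one, smul_eq_mul]
  push_cast
  field_simp

/-- The right-hand side of Hermite's formula for the Hurwitz zeta function. -/
noncomputable def hermiteZeta (s a : ℂ) : ℂ :=
  a ^ (-s) / 2 + a ^ (1 - s) / (s - 1) +
    Real.pi * a ^ (2 - s) / (s - 1) * hermiteIntegral (1 - s) a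

/-- Fubini for `hermiteKernel`: the y-integral first gives the Hermite integrand, the t-integral
first gives the remainder of 1/(1-e^(-y)). -/
theorem hermiteIntegral_ofReal {σ : ℂ} (hσ : 0 < σ.re) {a : ℝ} (ha : 0 < a) :
    IntegrableOn (fun y : ℝ => (y : ℂ) ^ σ * exp (-(a * y)) *
        (1 / (1 - exp (-y)) - 1 / 2 - 1 / y)) (Ioi 0) ∧
    Gamma σ * a ^ (-σ) * hermiteIntegral (-σ) a = (1 / (a * Real.pi)) *
      ∫ y : ℝ in Ioi 0, (y : ℂ) ^ σ * exp (-(a * y)) * (1 / (1 - exp (-y)) - 1 / 2 - 1 / y) := by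
  have hint := integrable_hermiteKernel hσ ha
  have ha' : (a : ℂ) ≠ 0 := ofReal_ne_zero.2 ha.ne'
  have hpi : (Real.pi : ℂ) ≠ 0 := ofReal_ne_zero.2 Real.pi_ne_zero
  have hcongr : EqOn (fun y => ∫ t in Ioi 0, hermiteKernel σ a t y)
      (fun y : ℝ => (1 / (a * Real.pi)) * ((y : ℂ) ^ σ * exp (-(a * y)) *
        (1 / (1 - exp (-y)) - 1 / 2 - 1 / y))) (Ioi 0) :=
    fun y hy => integral_hermiteKernel_left σ ha hy
  constructor
  · have h1 : IntegrableOn (fun y => ∫ t in Ioi 0, hermiteKernel σ a t y) (Ioi 0) :=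
      hint.integral_prod_right
    refine ((h1.congr_fun hcongr measurableSet_Ioi).const_mul (a * Real.pi : ℂ)).congr
      (Eventually.of_forall fun y => ?_)
    beta_reduce
    field_simp
  · rw [← integral_const_mul, ← setIntegral_congr_fun measurableSet_Ioi hcongr,
      ← integral_integral_swap hint, hermiteIntegral, ← integral_const_mul]
    refine integral_congr_ae (Eventually.of_forall fun t => ?_)
    simp only [hermiteKernel]
    rw [integral_const_mul, integral_cpow_mul_exp_neg_mul_one_sub_cos hσ ha, hermiteIntegrand]
    ring

theorem hasSum_hermiteZeta_ofReal {s : ℂ} (hs : 1 < s.re) {a : ℝ} (ha : 0 < a) :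
    HasSum (fun j : ℕ => ((j : ℂ) + a) ^ (-s)) (hermiteZeta s a) := by
  have hs0 : 0 < s.re := by linarith
  have hσ : 0 < (s - 1).re := by simpa using hs
  have r0 : 0 < (a : ℂ).re := by simpa using ha
  have ha' : (a : ℂ) ≠ 0 := ofReal_ne_zero.2 ha.ne'
  have hpi : (Real.pi : ℂ) ≠ 0 := ofReal_ne_zero.2 Real.pi_ne_zero
  have hΓ : Gamma s = (s - 1) * Gamma (s - 1) := by
    have := Gamma_add_one (s - 1) (fun h => by rw [h] at hσ; simp at hσ)
    rwa [sub_add_cancel] at this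
  have hΓ0 : Gamma (s - 1) ≠ 0 := Gamma_ne_zero_of_re_pos hσ
  have hs1 : s - 1 ≠ 0 := fun h => by rw [h] at hσ; simp at hσ
  obtain ⟨i0, hI⟩ := hermiteIntegral_ofReal hσ ha
  have i1 := integrableOn_cpow_mul_exp_neg_mul hs0 r0
  have i2 := integrableOn_cpow_mul_exp_neg_mul hσ r0
  have hm := hasSum_mellin (ι := ℕ) (a := fun _ => 1) (p := fun j => j + a)
    (F := fun y => exp (-(a * y)) / (1 - exp (-y))) (s := s)
    (fun j => Or.inr (by positivity)) hs0 ?_ ?_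
  · have hmel : mellin (fun y : ℝ => exp (-(a * y)) / (1 - exp (-y))) s =
        Gamma s * hermiteZeta s a := by
      -- The three summands yield, in order, the Hermite integral, a^(-s)/2 and a^(1-s)/(s-1), after
      -- Γ(s) = (s-1)Γ(s-1).
      have hsplit : mellin (fun y : ℝ => exp (-(a * y)) / (1 - exp (-y))) s =
          ∫ y : ℝ in Ioi 0, ((y : ℂ) ^ (s - 1) * exp (-(a * y)) *
            (1 / (1 - exp (-y)) - 1 / 2 - 1 / y) + ((y : ℂ) ^ (s - 1) * exp (-(a * y)) / 2 +
            (y : ℂ) ^ (s - 1 - 1) * exp (-(a * y)))) := by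
        refine setIntegral_congr_fun measurableSet_Ioi fun y hy => ?_
        have hy' : (y : ℂ) ≠ 0 := ofReal_ne_zero.2 (ne_of_gt hy)
        rw [smul_eq_mul, cpow_sub (s - 1) 1 hy', cpow_one]
        ring
      have i12 : IntegrableOn (fun y : ℝ => (y : ℂ) ^ (s - 1) * exp (-(a * y)) / 2 +
            (y : ℂ) ^ (s - 1 - 1) * exp (-(a * y))) (Ioi 0) := (i1.div_const 2).add i2
      have hI' : ∫ y : ℝ in Ioi 0, (y : ℂ) ^ (s - 1) * exp (-(a * y)) *
            (1 / (1 - exp (-y)) - 1 / 2 - 1 / y) =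
          a * Real.pi * (Gamma (s - 1) * a ^ (-(s - 1)) * hermiteIntegral (-(s - 1)) a) := by
        rw [hI]; field_simp
      rw [hsplit, integral_add i0 i12, integral_add (i1.div_const 2) i2, integral_div, hI',
        integral_cpow_mul_exp_neg_mul_of_re_pos hs0 r0,
        integral_cpow_mul_exp_neg_mul_of_re_pos hσ r0, hermiteZeta, hΓ, neg_sub]
      have : (a : ℂ) ^ (2 - s) = a * a ^ (1 - s) := by
        rw [show (2 - s : ℂ) = 1 + (1 - s) by ring, cpow_add _ _ ha', cpow_one]
      rw [this]
      field_simp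
      ring
    rw [hmel] at hm
    have hΓs : Gamma s ≠ 0 := Gamma_ne_zero_of_re_pos hs0
    have := hm.mul_left (Gamma s)⁻¹
    rw [inv_mul_cancel_left₀ hΓs] at this
    convert! this using 2 with j
    push_cast
    rw [cpow_neg]
    field_simp
  · intro y hy
    have hy0 : 0 < y := hy
    have hq : ‖exp (-y : ℂ)‖ < 1 := by
      rw [Complex.norm_exp]
      exact Real.exp_lt_one_iff.2 (by simpa using hy0)
    have := (hasSum_geometric_of_norm_lt_one hq).mul_left (exp (-(a * y) : ℂ))
    rw [← div_eq_mul_inv] at this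
    convert! this using 2 with j
    rw [← exp_nat_mul, ← exp_add]
    push_cast
    ring_nf
  · have := (Real.summable_one_div_nat_add_rpow a s.re).2 hs
    refine this.congr fun j => ?_
    rw [abs_of_pos (by positivity)]
    simp

/-! ### Extension to complex a and to all s ≠ 1. -/

theorem norm_natCast_add_cpow_neg_le {s w : ℂ} {δ : ℝ} (hs : 0 ≤ s.re) (hδ : 0 < δ)
    (hw : δ ≤ w.re) (j : ℕ) :
    ‖((j : ℂ) + w) ^ (-s)‖ ≤ Real.exp (Real.pi * |s.im|) * (1 / |(j : ℝ) + δ| ^ s.re) := by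
  have hpos : 0 < (j : ℝ) + δ := by positivity
  have hn : (j : ℝ) + δ ≤ ‖(j : ℂ) + w‖ := by
    refine le_trans ?_ (Complex.re_le_norm _)
    simpa using hw
  refine (Complex.norm_cpow_le _ _).trans ?_
  rw [abs_of_pos hpos, div_eq_mul_inv, ← Real.exp_neg, mul_comm, neg_re, neg_im,
    Real.rpow_neg (norm_nonneg _), one_div]
  refine mul_le_mul (Real.exp_le_exp.2 ?_) ?_ (by positivity) (by positivity)
  · calc _ ≤ |-(((j : ℂ) + w).arg * -s.im)| := le_abs_self _
      _ = |((j : ℂ) + w).arg| * |s.im| := by rw [abs_neg, abs_mul, abs_neg]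
      _ ≤ Real.pi * |s.im| := by gcongr; exact abs_arg_le_pi _
  · exact inv_anti₀ (by positivity) (Real.rpow_le_rpow hpos.le hn hs)

theorem summable_natCast_add_cpow_bound {s : ℂ} (hs : 1 < s.re) (δ : ℝ) :
    Summable fun j : ℕ => Real.exp (Real.pi * |s.im|) * (1 / |(j : ℝ) + δ| ^ s.re) :=
  ((Real.summable_one_div_nat_add_rpow δ s.re).2 hs).mul_left _

theorem differentiableOn_tsum_natCast_add_cpow {s : ℂ} (hs : 1 < s.re) :
    DifferentiableOn ℂ (fun a : ℂ => ∑' j : ℕ, ((j : ℂ) + a) ^ (-s)) {a | 0 < a.re} := by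
  intro a ha
  have ha0 : 0 < a.re := ha
  have hopen : IsOpen {w : ℂ | a.re / 2 < w.re} := isOpen_lt continuous_const continuous_re
  have ha2 : a.re / 2 < a.re := by linarith
  refine DifferentiableAt.differentiableWithinAt (DifferentiableOn.differentiableAt
    (s := {w : ℂ | a.re / 2 < w.re}) ?_ (hopen.mem_nhds ha2))
  refine differentiableOn_tsum_of_summable_norm (summable_natCast_add_cpow_bound hs (a.re / 2))
    (fun j w hw => ?_) hopen fun j w hw =>
      norm_natCast_add_cpow_neg_le (by linarith) (half_pos ha0) (le_of_lt hw) j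
  have hw' : a.re / 2 < w.re := hw
  have hre : 0 < ((j : ℂ) + w).re := by
    simp only [add_re, natCast_re]
    have : (0 : ℝ) ≤ j := j.cast_nonneg
    linarith
  exact ((differentiableAt_id.const_add (j : ℂ)).cpow_const
    (Or.inl hre)).differentiableWithinAt

theorem differentiableOn_hermiteZeta_right (s : ℂ) :
    DifferentiableOn ℂ (fun a => hermiteZeta s a) {a | 0 < a.re} := by
  have hp : ∀ c : ℂ, DifferentiableOn ℂ (fun a : ℂ => a ^ c) {a | 0 < a.re} := fun c a ha =>
    (differentiableAt_id.cpow_const (Or.inl ha)).differentiableWithinAt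
  exact (((hp _).div_const _).add ((hp _).div_const _)).add
    ((((hp _).const_mul _).div_const _).mul (differentiableOn_hermiteIntegral_right _))

theorem differentiableOn_hermiteZeta_left {a : ℂ} (ha : 0 < a.re) :
    DifferentiableOn ℂ (fun s => hermiteZeta s a) {1}ᶜ := by
  have ha0 : a ≠ 0 := fun h => by simp [h] at ha
  have hI := differentiable_hermiteIntegral_left ha
  intro s hs
  have hs1 : s - 1 ≠ 0 := sub_ne_zero.2 hs
  refine DifferentiableAt.differentiableWithinAt ?_
  unfold hermiteZeta
  have hp : ∀ f : ℂ → ℂ, DifferentiableAt ℂ f s → DifferentiableAt ℂ (fun s => a ^ f s) s :=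
    fun f hf => hf.const_cpow (Or.inl ha0)
  have h1 : DifferentiableAt ℂ (fun s : ℂ => s - 1) s := by fun_prop
  refine (((hp _ (by fun_prop)).div_const _).add ((hp _ (by fun_prop)).div h1 hs1)).add
    ((((hp _ (by fun_prop)).const_mul _).div h1 hs1).mul ?_)
  exact DifferentiableAt.comp (g := fun c => hermiteIntegral c a) (f := fun s => 1 - s) s
    (hI _) (by fun_prop)

/-- Both sides are holomorphic in `a` on the half-plane and agree on the positive reals. -/
theorem hasSum_hermiteZeta {s : ℂ} (hs : 1 < s.re) {a : ℂ} (ha : 0 < a.re) :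
    HasSum (fun j : ℕ => ((j : ℂ) + a) ^ (-s)) (hermiteZeta s a) := by
  have hsum : Summable (fun j : ℕ => ((j : ℂ) + a) ^ (-s)) :=
    Summable.of_norm_bounded (summable_natCast_add_cpow_bound hs a.re) fun j =>
      norm_natCast_add_cpow_neg_le (by linarith) ha le_rfl j
  have := eqOn_re_pos_of_eq_ofReal (differentiableOn_tsum_natCast_add_cpow hs)
    (differentiableOn_hermiteZeta_right s)
    (fun x hx => (hasSum_hermiteZeta_ofReal hs hx).tsum_eq) ha
  exact (hsum.hasSum_iff).2 this

theorem eqOn_compl_one_of_eq_of_one_lt_re {f g : ℂ → ℂ} (hf : DifferentiableOn ℂ f {1}ᶜ)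
    (hg : DifferentiableOn ℂ g {1}ᶜ) (h : ∀ s : ℂ, 1 < s.re → f s = g s) :
    EqOn f g {1}ᶜ := by
  have hc : IsPreconnected ({1}ᶜ : Set ℂ) :=
    (isConnected_compl_singleton_of_one_lt_rank (by simp) (1 : ℂ)).isPreconnected
  refine (hf.analyticOnNhd isOpen_compl_singleton).eqOn_of_preconnected_of_eventuallyEq
    (hg.analyticOnNhd isOpen_compl_singleton) hc (z₀ := 2) (by simp) ?_
  filter_upwards [(isOpen_lt continuous_const continuous_re).mem_nhds
    (show (1 : ℝ) < (2 : ℂ).re by simp)] with s hs using h s hs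

theorem isHurwitzContinuation_hermiteZeta {b : ℂ} (hb : 0 < b.re) :
    IsHurwitzContinuation b (fun s => hermiteZeta s b) :=
  ⟨differentiableOn_hermiteZeta_left hb, fun _ hs => hasSum_hermiteZeta hs hb⟩

theorem isHurwitzContinuation_complexHurwitzZeta {b : ℂ} (hb : 0 < b.re) :
    IsHurwitzContinuation b (fun s => complexHurwitzZeta s b) := by
  have h : ∃ Z : ℂ → ℂ, IsHurwitzContinuation b Z := ⟨_, isHurwitzContinuation_hermiteZeta hb⟩
  have e : (fun s => complexHurwitzZeta s b) = h.choose := by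
    funext s
    simp only [complexHurwitzZeta, dif_pos h]
  rw [e]
  exact h.choose_spec

theorem complexHurwitzZeta_eq_hermiteZeta {b s : ℂ} (hb : 0 < b.re) (hs : s ≠ 1) :
    complexHurwitzZeta s b = hermiteZeta s b := by
  have h1 := isHurwitzContinuation_complexHurwitzZeta hb
  have h2 := isHurwitzContinuation_hermiteZeta hb
  exact eqOn_compl_one_of_eq_of_one_lt_re h1.1 h2.1
    (fun s hs => (h1.2 s hs).unique (h2.2 s hs)) hs

/-! ### The shift by n. -/

theorem re_natCast_add_pos {b : ℂ} (hb : 0 < b.re) (n : ℕ) : 0 < ((n : ℂ) + b).re := by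
  simp only [add_re, natCast_re]; positivity

/-- For Re s > 1 this splits off the first n terms of the series; the identity theorem in s does the
rest. -/
theorem hermiteZeta_eq_sum_add {b s : ℂ} (hb : 0 < b.re) (hs : s ≠ 1) (n : ℕ) :
    hermiteZeta s b = ∑ j ∈ Finset.range n, ((j : ℂ) + b) ^ (-s) + hermiteZeta s (n + b) := by
  refine eqOn_compl_one_of_eq_of_one_lt_re (f := fun s => hermiteZeta s b)
    (g := fun s => ∑ j ∈ Finset.range n, ((j : ℂ) + b) ^ (-s) + hermiteZeta s (n + b))
    (differentiableOn_hermiteZeta_left hb) ?_ (fun s hs => ?_) hs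
  · refine DifferentiableOn.add (DifferentiableOn.fun_sum fun j _ => ?_)
      (differentiableOn_hermiteZeta_left (re_natCast_add_pos hb n))
    have h0 : (j : ℂ) + b ≠ 0 := fun h => by
      have := re_natCast_add_pos hb j
      rw [h] at this; simp at this
    exact fun s _ => (differentiableAt_id.neg.const_cpow (Or.inl h0)).differentiableWithinAt
  · have h1 := hasSum_hermiteZeta hs hb
    have h2 := hasSum_hermiteZeta hs (re_natCast_add_pos hb n)
    rw [← h1.tsum_eq, ← h2.tsum_eq, ← h1.summable.sum_add_tsum_nat_add n]
    congr 1
    refine tsum_congr fun j => ?_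
    push_cast
    rw [add_assoc]

/-! ### The substitution t = tan v. -/

/-- Here 1 ± i tan v = e^(±iv)/cos v, and |v| < π makes e^(±icv) the principal power of e^(±iv). -/
theorem evenPow_tan (c : ℂ) {v : ℝ} (hv : v ∈ Ioo 0 (Real.pi / 2)) :
    evenPow c (Real.tan v) = cos (c * v) / cos v ^ c := by
  have hcos : 0 < Real.cos v := Real.cos_pos_of_mem_Ioo ⟨by linarith [hv.1, Real.pi_pos], hv.2⟩
  have hc : cos (v : ℂ) ≠ 0 := by rw [← ofReal_cos]; exact ofReal_ne_zero.2 hcos.ne'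
  have hpow : ∀ w : ℝ, |w| < Real.pi → exp (w * I) ^ c = exp (c * w * I) := fun w hw => by
    rw [cpow_def_of_ne_zero (exp_ne_zero _), log_exp]
    · ring_nf
    · simpa using (abs_lt.1 hw).1
    · simpa using (abs_lt.1 hw).2.le
  have hv1 : |v| < Real.pi := by rw [abs_of_pos hv.1]; linarith [hv.2, Real.pi_pos]
  have hinv : (((Real.cos v)⁻¹ : ℝ) : ℂ) ^ c = (cos v ^ c)⁻¹ := by
    rw [ofReal_inv, ofReal_cos, inv_cpow]
    rw [← ofReal_cos, arg_ofReal_of_nonneg hcos.le]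
    exact Real.pi_pos.ne
  have e1 : (1 + (Real.tan v : ℝ) * I : ℂ) = ((Real.cos v)⁻¹ : ℝ) * exp (v * I) := by
    rw [exp_mul_I, Real.tan_eq_sin_div_cos]
    push_cast
    field_simp
  have e2 : (1 - (Real.tan v : ℝ) * I : ℂ) = ((Real.cos v)⁻¹ : ℝ) * exp ((-v : ℝ) * I) := by
    rw [exp_mul_I, Real.tan_eq_sin_div_cos]
    push_cast
    rw [Complex.cos_neg, Complex.sin_neg]
    field_simp
    ring
  rw [evenPow, e1, e2, ofReal_mul_cpow (inv_pos.2 hcos) (exp_ne_zero _),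
    ofReal_mul_cpow (inv_pos.2 hcos) (exp_ne_zero _), hpow v hv1, hpow (-v) (by rwa [abs_neg]),
    hinv, show cos (c * v) = (exp (c * v * I) + exp (-(c * v) * I)) / 2 from rfl]
  push_cast
  ring_nf

theorem image_tan_Ioo_zero : Real.tan '' Ioo 0 (Real.pi / 2) = Ioi 0 := by
  ext x
  constructor
  · rintro ⟨v, hv, rfl⟩
    exact Real.tan_pos_of_pos_of_lt_pi_div_two hv.1 hv.2
  · intro hx
    exact ⟨Real.arctan x, ⟨Real.arctan_pos.2 hx, Real.arctan_lt_pi_div_two x⟩, Real.tan_arctan x⟩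

theorem cos_pos_of_mem_Ioo_zero {v : ℝ} (hv : v ∈ Ioo 0 (Real.pi / 2)) : 0 < Real.cos v :=
  Real.cos_pos_of_mem_Ioo ⟨by linarith [hv.1, Real.pi_pos], hv.2⟩

theorem abs_smul_hermiteIntegrand_tan (c a : ℂ) {v : ℝ} (hv : v ∈ Ioo 0 (Real.pi / 2)) :
    |1 / Real.cos v ^ 2| • hermiteIntegrand c a (Real.tan v) =
      (csec v * csch (Real.pi * a * tan v)) ^ 2 * (1 - cos (c * v) / cos v ^ c) := by
  rw [hermiteIntegrand, evenPow_tan c hv, abs_of_nonneg (by positivity), real_smul, csec]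
  push_cast
  ring

theorem intervalIntegrable_and_integral_eq_hermiteIntegral (c : ℂ) {a : ℂ} (ha : 0 < a.re) :
    IntervalIntegrable (fun v : ℝ => (csec v * csch (Real.pi * a * tan v)) ^ 2 *
      (1 - cos (c * v) / cos v ^ c)) volume 0 (Real.pi / 2) ∧
    ∫ v in (0 : ℝ)..(Real.pi / 2), (csec v * csch (Real.pi * a * tan v)) ^ 2 *
      (1 - cos (c * v) / cos v ^ c) = hermiteIntegral c a := by
  have hpi : (0 : ℝ) ≤ Real.pi / 2 := by positivity
  have hder : ∀ v ∈ Ioo 0 (Real.pi / 2),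
      HasDerivWithinAt Real.tan (1 / Real.cos v ^ 2) (Ioo 0 (Real.pi / 2)) v := fun v hv =>
    (Real.hasDerivAt_tan (cos_pos_of_mem_Ioo_zero hv).ne').hasDerivWithinAt
  have hinj : InjOn Real.tan (Ioo 0 (Real.pi / 2)) :=
    Real.injOn_tan.mono (Ioo_subset_Ioo_left (by linarith))
  have hcongr : EqOn (fun v => |1 / Real.cos v ^ 2| • hermiteIntegrand c a (Real.tan v))
      (fun v : ℝ => (csec v * csch (Real.pi * a * tan v)) ^ 2 * (1 - cos (c * v) / cos v ^ c))
      (Ioo 0 (Real.pi / 2)) := fun v hv => abs_smul_hermiteIntegrand_tan c a hv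
  constructor
  · rw [intervalIntegrable_iff_integrableOn_Ioo_of_le hpi]
    refine IntegrableOn.congr_fun ?_ hcongr measurableSet_Ioo
    rw [← integrableOn_image_iff_integrableOn_abs_deriv_smul measurableSet_Ioo hder hinj,
      image_tan_Ioo_zero]
    exact integrableOn_hermiteIntegrand c ha
  · rw [intervalIntegral.integral_of_le hpi, integral_Ioc_eq_integral_Ioo,
      ← setIntegral_congr_fun measurableSet_Ioo hcongr,
      ← integral_image_eq_integral_abs_deriv_smul measurableSet_Ioo hder hinj,
      image_tan_Ioo_zero, hermiteIntegral]

/-! ### The two summation formulas. -/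

/-- The shift at s = -k covers only j < n and contributes -(n+b)^k/2; adding the term j = n makes
this +(n+b)^k/2. -/
theorem sum_range_succ_cpow {k b : ℂ} (hk : k ≠ -1) (hb : 0 < b.re) (n : ℕ) :
    ∑ j ∈ Finset.range (n + 1), ((j : ℂ) + b) ^ k =
      (n + b) ^ (k + 1) / (k + 1) + (n + b) ^ k / 2 + complexHurwitzZeta (-k) b +
        Real.pi * (n + b) ^ (k + 2) / (k + 1) * hermiteIntegral (k + 1) (n + b) := by
  have hk1 : -k ≠ 1 := fun h => hk (by rw [← h, neg_neg])
  have hk2 : k + 1 ≠ 0 := fun h => hk (eq_neg_of_add_eq_zero_left h)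
  rw [complexHurwitzZeta_eq_hermiteZeta hb hk1, hermiteZeta_eq_sum_add hb hk1 n,
    Finset.sum_range_succ, hermiteZeta, show -k - 1 = -(k + 1) by ring,
    show 1 - -k = k + 1 by ring, show 2 - -k = k + 2 by ring, neg_neg, div_neg, div_neg]
  ring

theorem mainTheorem3 (k b : ℂ) (hk : k ≠ -1) (hb : 0 < b.re) :
    IsHurwitzContinuation b (fun s => complexHurwitzZeta s b) ∧
    ∀ n : ℕ,
      (IntervalIntegrable
          (fun v : ℝ => (csec (v : ℂ) * csch (Real.pi * (n + b) * Complex.tan (v : ℂ))) ^ 2 *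
            (1 - Complex.cos ((k + 1) * v) / Complex.cos (v : ℂ) ^ (k + 1)))
          MeasureTheory.volume 0 (Real.pi / 2) ∧
        ∑ j ∈ Finset.range (n + 1), ((j : ℂ) + b) ^ k =
          (n + b) ^ (k + 1) / (k + 1) + (n + b) ^ k / 2 + complexHurwitzZeta (-k) b +
          Real.pi * (n + b) ^ (k + 2) / (k + 1) *
            ∫ v in (0 : ℝ)..(Real.pi / 2),
              (csec (v : ℂ) * csch (Real.pi * (n + b) * Complex.tan (v : ℂ))) ^ 2 *
              (1 - Complex.cos ((k + 1) * v) / Complex.cos (v : ℂ) ^ (k + 1))) ∧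
      (IntervalIntegrable
          (fun v : ℝ => csec (v : ℂ) ^ 2 *
            ((n + b) ^ (k + 2) * csch (Real.pi * (n + b) * Complex.tan (v : ℂ)) ^ 2 -
              b ^ (k + 2) * csch (Real.pi * b * Complex.tan (v : ℂ)) ^ 2) *
            (1 - Complex.cos ((k + 1) * v) / Complex.cos (v : ℂ) ^ (k + 1)))
          MeasureTheory.volume 0 (Real.pi / 2) ∧
        ∑ j ∈ Finset.Icc 1 n, ((j : ℂ) + b) ^ k =
          ((n + b) ^ (k + 1) - b ^ (k + 1)) / (k + 1) + ((n + b) ^ k - b ^ k) / 2 +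
          Real.pi / (k + 1) *
            ∫ v in (0 : ℝ)..(Real.pi / 2),
              csec (v : ℂ) ^ 2 *
              ((n + b) ^ (k + 2) * csch (Real.pi * (n + b) * Complex.tan (v : ℂ)) ^ 2 -
                b ^ (k + 2) * csch (Real.pi * b * Complex.tan (v : ℂ)) ^ 2) *
              (1 - Complex.cos ((k + 1) * v) / Complex.cos (v : ℂ) ^ (k + 1))) := by

  refine ⟨isHurwitzContinuation_complexHurwitzZeta hb, fun n => ?_⟩
  have hnb := re_natCast_add_pos hb n
  obtain ⟨i1, e1⟩ := intervalIntegrable_and_integral_eq_hermiteIntegral (k + 1) hnb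
  obtain ⟨i0, e0⟩ := intervalIntegrable_and_integral_eq_hermiteIntegral (k + 1) hb
  have hS := sum_range_succ_cpow hk hb n
  have hpt : (fun v : ℝ => csec (v : ℂ) ^ 2 *
      ((n + b) ^ (k + 2) * csch (Real.pi * (n + b) * Complex.tan (v : ℂ)) ^ 2 -
        b ^ (k + 2) * csch (Real.pi * b * Complex.tan (v : ℂ)) ^ 2) *
      (1 - Complex.cos ((k + 1) * v) / Complex.cos (v : ℂ) ^ (k + 1))) = fun v : ℝ =>
      (n + b) ^ (k + 2) * ((csec v * csch (Real.pi * (n + b) * tan v)) ^ 2 *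
        (1 - cos ((k + 1) * v) / cos v ^ (k + 1))) -
      b ^ (k + 2) * ((csec v * csch (Real.pi * b * tan v)) ^ 2 *
        (1 - cos ((k + 1) * v) / cos v ^ (k + 1))) := by
    funext v; ring
  refine ⟨⟨i1, by rw [e1, hS]⟩, ?_, ?_⟩
  · rw [hpt]
    exact (i1.const_mul _).sub (i0.const_mul _)
  · rw [hpt, intervalIntegral.integral_sub (i1.const_mul _) (i0.const_mul _),
      intervalIntegral.integral_const_mul, intervalIntegral.integral_const_mul, e1, e0]
    -- Subtracting the case n = 0 removes both ζ(-k,b) and the j = 0 term.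
    have h0 := sum_range_succ_cpow hk hb 0
    have hIcc : Finset.Ico 1 (n + 1) = Finset.Icc 1 n := by
      ext j; simp only [Finset.mem_Ico, Finset.mem_Icc]; omega
    rw [Finset.range_eq_Ico, Finset.sum_eq_sum_Ico_succ_bot (Nat.succ_pos _), zero_add,
      hIcc] at hS
    simp only [zero_add, Finset.range_one, Finset.sum_singleton, Nat.cast_zero] at h0 hS
    linear_combination hS - h0
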